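/- Let $n\ge 1$ and $p\ge 1$ be integers and let $Y=\mu+\sigma\varepsilon$ be a random vector of $\mathbb{R}^n$, where $\mu\in\mathbb{R}^n$, $\sigma>0$ and $\varepsilon_1,\dots,\varepsilon_n$ are i.i.d. standard Gaussian random variables. Let $\mathcal{M}$ be the set of all subsets of $\{1,\dots,n\}$ with cardinality at most $p$. For $m\in\mathcal{M}$ let $S_m$ be the linear space of all $s\in\mathbb{R}^n$ such that $s_i=0$ for all $i\notin m$, let $D_m=\dim S_m$, and let $\Pi_m$ be the orthogonal projector of $\mathbb{R}^n$ onto $S_m$. Given a penalty function $\mathrm{pen}:\mathcal{M}\to[0,\infty)$, let $$\mathrm{Crit}(m)=\|Y-\Pi_mY\|^2\left(1+\frac{\mathrm{pen}(m)}{n-D_m}\right),\qquad m\in\mathcal{M}.$$ For every $C_0\in(0,1)$ there exist constants $c>0$ and $c'>0$, depending on $C_0$ only, such that the following holds. Assume that $1\le p\le(1-C_0)n$, that $n>e^{2/C_0}$, and that $\mathrm{pen}(m)\le 2C_0^4D_m\log n$ for all $m\in\mathcal{M}$. If $\mu=0$, then, whatever $\sigma>0$, any $\hat m$ that almost surely minimizes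 $\mathrm{Crit}$ over $\mathcal{M}$ satisfies $$\mathbb{P}\bigl(|\hat m|>\lfloor(1-C_0)D\rfloor\bigr)\ \ge\ 1-2\exp\left(-c\,\frac{n^{1-C_0}}{\sqrt{\log n}}\right),\qquad\text{where } D=\min\left\{\left\lfloor\frac{c'\,n^{1-C_0}}{(\log n)^{3/2}}\right\rfloor,\ p\right\}.$$ -/

import Mathlib

open MeasureTheory ProbabilityTheory

/-- The Gaussian regression model `Y_i = μ_i + σ ε_i`, for a given value `e` of the noise vector. -/
noncomputable def observation {n : ℕ} (μ : EuclideanSpace ℝ (Fin n)) (σ : ℝ) (e : Fin n → ℝ) :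
    EuclideanSpace ℝ (Fin n) :=
  WithLp.toLp 2 (fun i => μ i + σ * e i)

/-- The index set: all subsets of the `n` coordinates with cardinality not larger than `p`. -/
def modelIndices (n p : ℕ) : Set (Finset (Fin n)) :=
  {m | m.card ≤ p}

/-- The model `S_m`: the vectors `s` of `ℝⁿ` such that `s_i = 0` for all `i ∉ m`. -/
def modelSpace {n : ℕ} (m : Finset (Fin n)) : Submodule ℝ (EuclideanSpace ℝ (Fin n)) where
  carrier := {s | ∀ i, i ∉ m → s i = 0}
  add_mem' := by
    intro a b ha hb i hi
    simp [ha i hi, hb i hi]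
  zero_mem' := by
    intro i _
    simp
  smul_mem' := by
    intro c a ha i hi
    simp [ha i hi]

/-- The dimension `D_m` of the model `S_m`. -/
noncomputable def modelDim {n : ℕ} (m : Finset (Fin n)) : ℕ :=
  Module.finrank ℝ (modelSpace m)

/-- The penalized criterion `‖y - Π_m y‖² (1 + pen(m) / (n - D_m))`, where `Π_m` is the orthogonal
projector of `ℝⁿ` onto `S_m`. -/
noncomputable def crit {n : ℕ} (pen : Finset (Fin n) → ℝ) (y : EuclideanSpace ℝ (Fin n))
    (m : Finset (Fin n)) : ℝ :=
  ‖y - (modelSpace m).starProjection y‖ ^ 2 * (1 + pen m / ((n : ℝ) - (modelDim m : ℝ)))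

/-- `m` minimizes the penalized criterion over the models of cardinality at most `p`. -/
def IsSelected {n : ℕ} (p : ℕ) (pen : Finset (Fin n) → ℝ) (y : EuclideanSpace ℝ (Fin n))
    (m : Finset (Fin n)) : Prop :=
  m ∈ modelIndices n p ∧ ∀ m' ∈ modelIndices n p, crit pen y m ≤ crit pen y m'

/-- The dimension `D = ⌊c' n^{1 - C₀} / log^{3/2} n⌋ ∧ p`. -/
noncomputable def overfitDim (C₀ c' : ℝ) (n p : ℕ) : ℕ :=
  min ⌊c' * (n : ℝ) ^ (1 - C₀) / Real.log n ^ (3 / 2 : ℝ)⌋₊ p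

/-! For `μ = 0` the residual of `m` is `σ²` times the sum of `ε i ^ 2` off `m`. Suppose at least `D`
coordinates satisfy `ε i ^ 2 ≥ T = 2 C₀ log n`. A model with at most `(1 - C₀) D` elements can then
be completed to size `D` by such coordinates: after division by `σ²`, the residual drops by at least
`C₀ D T`, while the added penalty costs at most `R B D / (n - D)`, where `R = r n` bounds the sum of
all squares and `B = 2 C₀⁴ log n`. Since `r C₀² n < n - D`, the gain wins
(`floor_lt_card_of_isSelected`).

Both requirements on the noise hold up to probability `exp (-c x)`, `x = n^(1 - C₀) / √(log n)`, by
Chernoff bounds: the expected number of exceedances of `√T` is at least `κ x`, and `r > 1` makes a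
sum of squares above `r n` exponentially unlikely. -/

lemma norm_sub_starProjection_modelSpace_sq {n : ℕ} (m : Finset (Fin n))
    (y : EuclideanSpace ℝ (Fin n)) :
    ‖y - (modelSpace m).starProjection y‖ ^ 2 = ∑ i ∈ mᶜ, y i ^ 2 := by
  have hproj : (modelSpace m).starProjection y =
      WithLp.toLp 2 (fun i => if i ∈ m then y i else 0) := by
    apply Submodule.eq_starProjection_of_mem_of_inner_eq_zero
    · intro i hi
      simp [hi]
    · intro w hw
      rw [PiLp.inner_apply]
      refine Finset.sum_eq_zero fun i _ => ?_
      by_cases hi : i ∈ m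
      · simp [hi]
      · simp [hw i hi]
  rw [hproj, EuclideanSpace.norm_sq_eq, ← Finset.sum_subset (Finset.subset_univ mᶜ)]
  · refine Finset.sum_congr rfl fun i hi => ?_
    simp [Finset.mem_compl.1 hi]
  · intro i _ hi
    simp [not_not.1 (mt Finset.mem_compl.2 hi)]

lemma modelDim_eq_card {n : ℕ} (m : Finset (Fin n)) : modelDim m = m.card := by
  let e : modelSpace m ≃ₗ[ℝ] (m → ℝ) :=
    { toFun := fun s i => s.1 i
      map_add' := fun a b => rfl
      map_smul' := fun c a => rfl
      invFun := fun f => ⟨WithLp.toLp 2 (fun i => if h : i ∈ m then f ⟨i, h⟩ else 0), by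
        intro i hi
        simp [hi]⟩
      left_inv := by
        rintro ⟨s, hs⟩
        ext i
        by_cases hi : i ∈ m
        · simp [hi]
        · simp [hi, hs i hi]
      right_inv := by
        intro f
        ext i
        simp }
  rw [modelDim, e.finrank_eq, Module.finrank_fintype_fun_eq_card, Fintype.card_coe]

/-- If at least `D` coordinates of the noise are large and its norm is not too large, a selected
model with few coordinates could be improved by adding large coordinates to it. -/
lemma floor_lt_card_of_isSelected {n p D : ℕ} {C₀ σ B R T : ℝ} {pen : Finset (Fin n) → ℝ}
    {e : Fin n → ℝ} {m : Finset (Fin n)} (hC₀ : C₀ < 1) (hσ : 0 < σ) (hB : 0 ≤ B) (hT : 0 ≤ T)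
    (hpn : p < n) (hDp : D ≤ p)
    (hpen₀ : ∀ m ∈ modelIndices n p, 0 ≤ pen m)
    (hpen : ∀ m ∈ modelIndices n p, pen m ≤ B * modelDim m)
    (hm : IsSelected p pen (observation 0 σ e) m)
    (hlarge : D ≤ (Finset.univ.filter fun i => T ≤ e i ^ 2).card)
    (hR : ∑ i, e i ^ 2 ≤ R)
    (hgap : R * (B * D) < ((n : ℝ) - D) * (C₀ * D * T)) :
    ⌊(1 - C₀) * (D : ℝ)⌋₊ < m.card := by
  by_contra! hcard
  have hcard' : (m.card : ℝ) ≤ (1 - C₀) * D :=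
    (Nat.le_floor_iff (mul_nonneg (by linarith) (Nat.cast_nonneg D))).1 hcard
  have hD : (D : ℝ) ≠ 0 := by
    intro h
    simp [h] at hgap
  have hDpos : (0 : ℝ) < D := lt_of_le_of_ne (Nat.cast_nonneg D) hD.symm
  -- The sign of `C₀` is not assumed; it is read off `hgap`, whose left side is nonnegative.
  have hC₀D : 0 ≤ C₀ * D := by
    have hr : 0 ≤ R := (Finset.sum_nonneg fun i _ => sq_nonneg (e i)).trans hR
    have hnD : (0 : ℝ) < (n : ℝ) - D := by
      have : (D : ℝ) < n := by exact_mod_cast hDp.trans_lt hpn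
      linarith
    have h1 : 0 < ((n : ℝ) - D) * (C₀ * D * T) :=
      lt_of_le_of_lt (mul_nonneg hr (mul_nonneg hB hDpos.le)) hgap
    have h2 := (mul_pos_iff_of_pos_left hnD).1 h1
    exact (pos_of_mul_pos_left h2 hT).le
  have hmD : m.card ≤ D := by
    have : (m.card : ℝ) ≤ D := by linarith
    exact_mod_cast this
  set J := Finset.univ.filter fun i => T ≤ e i ^ 2 with hJ
  have hJm : D - m.card ≤ (J \ m).card := by
    have := Finset.le_card_sdiff m J
    omega
  obtain ⟨u, huJ, hu⟩ := Finset.exists_subset_card_eq hJm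
  have hdisj : Disjoint m u := by
    rw [Finset.disjoint_right]
    exact fun i hi => (Finset.mem_sdiff.1 (huJ hi)).2
  have hcardu : (m ∪ u).card = D := by
    rw [Finset.card_union_of_disjoint hdisj, hu]
    omega
  have hmem : m ∪ u ∈ modelIndices n p := by
    change (m ∪ u).card ≤ p
    omega
  have hle := hm.2 _ hmem
  have hpen₁ := hpen _ hmem
  have hpen₂ := hpen₀ _ hmem
  have hpenm := hpen₀ _ hm.1
  have hDn : (D : ℝ) < n := by exact_mod_cast hDp.trans_lt hpn
  have hmn : (m.card : ℝ) < n := by exact_mod_cast (hmD.trans hDp).trans_lt hpn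
  simp only [crit, norm_sub_starProjection_modelSpace_sq, modelDim_eq_card, hcardu, observation,
    PiLp.zero_apply, zero_add, mul_pow, ← Finset.mul_sum] at hle hpen₁
  have hσ2 : 0 < σ ^ 2 := by positivity
  rw [mul_assoc, mul_assoc, mul_le_mul_iff_right₀ hσ2] at hle
  have hsplit : ∑ i ∈ mᶜ, e i ^ 2 = ∑ i ∈ (m ∪ u)ᶜ, e i ^ 2 + ∑ i ∈ u, e i ^ 2 := by
    have hum : u ⊆ mᶜ := fun i hi => Finset.mem_compl.2 (Finset.disjoint_right.1 hdisj hi)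
    rw [← Finset.sum_sdiff hum]
    congr 2
    ext i
    simp
  have husum : ((D : ℝ) - m.card) * T ≤ ∑ i ∈ u, e i ^ 2 := by
    have h := Finset.card_nsmul_le_sum u (fun i => e i ^ 2) T fun i hi => by
      have := (Finset.mem_sdiff.1 (huJ hi)).1
      exact (Finset.mem_filter.1 this).2
    rwa [hu, nsmul_eq_mul, Nat.cast_sub hmD] at h
  have hVR : ∑ i ∈ (m ∪ u)ᶜ, e i ^ 2 ≤ R :=
    (Finset.sum_le_univ_sum_of_nonneg fun i => sq_nonneg (e i)).trans hR
  have hV0 : 0 ≤ ∑ i ∈ (m ∪ u)ᶜ, e i ^ 2 := Finset.sum_nonneg fun i _ => sq_nonneg _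
  have hW0 : 0 ≤ ∑ i ∈ mᶜ, e i ^ 2 := Finset.sum_nonneg fun i _ => sq_nonneg _
  have h1 : ∑ i ∈ mᶜ, e i ^ 2 ≤ ∑ i ∈ mᶜ, e i ^ 2 * (1 + pen m / ((n : ℝ) - m.card)) :=
    Finset.sum_le_sum fun i _ => le_mul_of_one_le_right (sq_nonneg _) (by
      have : 0 ≤ pen m / ((n : ℝ) - m.card) := div_nonneg hpenm (by linarith)
      linarith)
  rw [← Finset.sum_mul] at h1
  set V := ∑ i ∈ (m ∪ u)ᶜ, e i ^ 2
  have h2 : ((D : ℝ) - m.card) * T ≤ V * (pen (m ∪ u) / ((n : ℝ) - D)) := by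
    rw [hsplit] at h1 hle
    linarith
  have h3 : V * (pen (m ∪ u) / ((n : ℝ) - D)) ≤ R * (B * D) / ((n : ℝ) - D) := by
    rw [mul_div_assoc]
    have : pen (m ∪ u) / ((n : ℝ) - D) ≤ B * D / ((n : ℝ) - D) :=
      div_le_div_of_nonneg_right hpen₁ (by linarith)
    exact mul_le_mul hVR this (div_nonneg hpen₂ (by linarith)) (hV0.trans hVR)
  have h4 : R * (B * D) / ((n : ℝ) - D) < C₀ * D * T := by
    rw [div_lt_iff₀ (by linarith)]
    linarith
  have h5 : C₀ * D * T ≤ ((D : ℝ) - m.card) * T :=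
    mul_le_mul_of_nonneg_right (by linarith) hT
  linarith

/-- Chernoff's bound for a sum of i.i.d. random variables of the form `g (ε i)`. -/
lemma measureReal_sum_comp_ge_le {n : ℕ} {Ω : Type*} [MeasurableSpace Ω] {P : Measure Ω}
    [IsProbabilityMeasure P] {ε : Fin n → Ω → ℝ} {ν : Measure ℝ}
    (hlaw : ∀ i, HasLaw (ε i) ν P) (hindep : iIndepFun ε P) {g : ℝ → ℝ} (hg : Measurable g)
    {t : ℝ} (ht : 0 ≤ t) (hmgf : 0 < mgf g ν t) (a : ℝ) :
    P.real {ω | a ≤ ∑ i, g (ε i ω)} ≤ Real.exp (-t * a) * mgf g ν t ^ n := by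
  have hX : iIndepFun (fun i => g ∘ ε i) P := hindep.comp (fun _ => g) fun _ => hg
  have hmeas : ∀ i, AEMeasurable (g ∘ ε i) P := fun i =>
    hg.comp_aemeasurable (hlaw i).aemeasurable
  have hone : ∀ i, mgf (g ∘ ε i) P t = mgf g ν t := fun i =>
    (hlaw i).integral_comp (f := fun x => Real.exp (t * g x)) (by fun_prop)
  have hsum : mgf (∑ i, g ∘ ε i) P t = mgf g ν t ^ n := by
    rw [hX.mgf_sum₀ hmeas]
    simp [hone]
  have hint : Integrable (fun ω => Real.exp (t * (∑ i, g ∘ ε i) ω)) P := by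
    -- A non-integrable exponential would have `mgf` equal to `0` by convention.
    by_contra h
    have := mgf_undef h
    rw [hsum] at this
    exact (pow_pos hmgf n).ne' this
  have := measure_ge_le_exp_mul_mgf a ht hint
  rw [hsum] at this
  simpa using this

/-- The exponential moment of the square of a standard Gaussian variable. -/
lemma mgf_sq_gaussianReal {r : ℝ} (hr : 0 < r) :
    mgf (fun x => x ^ 2) (gaussianReal 0 1) ((1 - r⁻¹) / 2) = √r := by
  rw [mgf, integral_gaussianReal_eq_integral_smul one_ne_zero]
  have h : ∀ x : ℝ, gaussianPDFReal 0 1 x • Real.exp ((1 - r⁻¹) / 2 * x ^ 2) =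
      (√(2 * Real.pi))⁻¹ * Real.exp (-(r⁻¹ / 2) * x ^ 2) := by
    intro x
    simp only [gaussianPDFReal, smul_eq_mul, NNReal.coe_one, mul_one, sub_zero]
    rw [mul_assoc, ← Real.exp_add]
    congr 2
    ring
  simp_rw [h]
  rw [integral_const_mul, integral_gaussian, ← Real.sqrt_inv, ← Real.sqrt_mul (by positivity)]
  congr 1
  field_simp

/-- The sum of squares of i.i.d. standard Gaussian variables exceeds `r n`, `r > 1`, with
exponentially small probability. -/
lemma measureReal_sum_sq_ge_le {n : ℕ} {Ω : Type*} [MeasurableSpace Ω] {P : Measure Ω}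
    [IsProbabilityMeasure P] {ε : Fin n → Ω → ℝ}
    (hlaw : ∀ i, HasLaw (ε i) (gaussianReal 0 1) P) (hindep : iIndepFun ε P)
    {r : ℝ} (hr : 1 < r) :
    P.real {ω | r * n ≤ ∑ i, ε i ω ^ 2} ≤ Real.exp (-((r - 1 - Real.log r) / 2) * n) := by
  have hr0 : 0 < r := by linarith
  have hinv : r⁻¹ ≤ 1 := inv_le_one_of_one_le₀ hr.le
  have hmgf := mgf_sq_gaussianReal hr0
  -- `(1 - r⁻¹) / 2` is the optimal Chernoff parameter for the level `r n`.
  have h := measureReal_sum_comp_ge_le hlaw hindep (g := fun x => x ^ 2) (by fun_prop)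
    (t := (1 - r⁻¹) / 2) (by linarith) (by rw [hmgf]; positivity) (r * n)
  refine h.trans_eq ?_
  rw [hmgf, ← Real.exp_log (Real.sqrt_pos.2 hr0), ← Real.exp_nat_mul, ← Real.exp_add,
    Real.log_sqrt hr0.le]
  congr 1
  field_simp
  ring

/-- A lower bound for the tail of the standard Gaussian distribution. -/
lemma le_gaussianReal_real_Ici {t : ℝ} (ht : 2 ≤ t) :
    Real.exp (-(9 / 8)) / √(2 * Real.pi) * (Real.exp (-(t ^ 2 / 2)) / t) ≤
      (gaussianReal 0 1).real (Set.Ici t) := by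
  have ht0 : 0 < t := by linarith
  have hval : (gaussianReal 0 1).real (Set.Icc t (t + t⁻¹)) =
      ∫ x in Set.Icc t (t + t⁻¹), gaussianPDFReal 0 1 x := by
    rw [Measure.real, gaussianReal_apply_eq_integral _ one_ne_zero, ENNReal.toReal_ofReal]
    exact integral_nonneg fun x => gaussianPDFReal_nonneg _ _ _
  have hconst : ∫ x in Set.Icc t (t + t⁻¹),
      Real.exp (-(9 / 8)) / √(2 * Real.pi) * Real.exp (-(t ^ 2 / 2)) =
      Real.exp (-(9 / 8)) / √(2 * Real.pi) * (Real.exp (-(t ^ 2 / 2)) / t) := by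
    rw [setIntegral_const, Real.volume_real_Icc_of_le (by simp [ht0.le])]
    simp only [add_sub_cancel_left, smul_eq_mul]
    field_simp
  -- On `[t, t + 1/t]` the exponent `x² / 2` is at most `t² / 2 + 1 + 1 / (2 t²)`, and `t ≥ 2` gives
  -- the `9/8`.
  calc _ ≤ (gaussianReal 0 1).real (Set.Icc t (t + t⁻¹)) := by
        rw [hval, ← hconst]
        refine setIntegral_mono_on (integrableOn_const (by simp))
          (integrable_gaussianPDFReal 0 1).integrableOn measurableSet_Icc fun x hx => ?_
        simp only [gaussianPDFReal, NNReal.coe_one, mul_one, sub_zero]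
        rw [div_mul_eq_mul_div, ← Real.exp_add, div_eq_inv_mul]
        refine mul_le_mul_of_nonneg_left (Real.exp_le_exp.2 ?_) (by positivity)
        have hx2 : x ^ 2 ≤ (t + t⁻¹) ^ 2 := by
          have := hx.1
          exact pow_le_pow_left₀ (by linarith) hx.2 2
        have hti : t⁻¹ ≤ 1 / 2 := by
          rw [one_div]
          exact inv_anti₀ (by norm_num) ht
        have hti0 : 0 < t⁻¹ := by positivity
        have : t * t⁻¹ = 1 := mul_inv_cancel₀ ht0.ne'
        nlinarith
    _ ≤ _ := measureReal_mono Set.Icc_subset_Ici_self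

/-- A lower deviation bound for the number of exceedances of `t` by i.i.d. variables. -/
lemma measureReal_card_exceedances_le {n : ℕ} {Ω : Type*} [MeasurableSpace Ω] {P : Measure Ω}
    [IsProbabilityMeasure P] {ε : Fin n → Ω → ℝ} {ν : Measure ℝ} [IsProbabilityMeasure ν]
    (hlaw : ∀ i, HasLaw (ε i) ν P) (hindep : iIndepFun ε P) (t s : ℝ) :
    P.real {ω | ((Finset.univ.filter fun i => t ≤ ε i ω).card : ℝ) ≤ s} ≤
      Real.exp (s - 3 / 5 * (n * ν.real (Set.Ici t))) := by
  -- Chernoff at parameter `1` for minus the count; `3/5` comes from `1 - e⁻¹ ≥ 3/5`.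
  set g : ℝ → ℝ := (Set.Ici t).indicator fun _ => -1 with hg
  set q := ν.real (Set.Ici t) with hq
  have hgm : Measurable g := measurable_const.indicator measurableSet_Ici
  have hmgf : mgf g ν 1 = 1 - (1 - Real.exp (-1)) * q := by
    have : ∀ x, Real.exp (1 * g x) =
        1 - (Set.Ici t).indicator (fun _ => 1 - Real.exp (-1)) x := by
      intro x
      by_cases hx : x ∈ Set.Ici t <;> simp [hg, hx]
    rw [mgf]
    simp_rw [this]
    rw [integral_sub (integrable_const _) ((integrable_const _).indicator measurableSet_Ici),
      integral_indicator measurableSet_Ici, setIntegral_const]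
    simp [hq, mul_comm]
  have hq1 : q ≤ 1 := measureReal_le_one
  have hq0 : 0 ≤ q := measureReal_nonneg
  have he : Real.exp (-1) ≤ 2 / 5 := by
    rw [Real.exp_neg, inv_le_comm₀ (Real.exp_pos 1) (by norm_num)]
    have := Real.exp_one_gt_d9
    norm_num
    linarith
  have he0 := Real.exp_pos (-1)
  have hpos : 0 < mgf g ν 1 := by
    rw [hmgf]
    nlinarith
  have h := measureReal_sum_comp_ge_le hlaw hindep hgm zero_le_one hpos (-s)
  have hset : {ω | ((Finset.univ.filter fun i => t ≤ ε i ω).card : ℝ) ≤ s} =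
      {ω | -s ≤ ∑ i, g (ε i ω)} := by
    ext ω
    simp [hg, Set.indicator_apply, Finset.sum_ite]
  rw [hset]
  refine h.trans ?_
  have hle : mgf g ν 1 ≤ Real.exp (-(3 / 5 * q)) := by
    refine le_trans ?_ (Real.one_sub_le_exp_neg _)
    rw [hmgf]
    nlinarith
  calc _ ≤ Real.exp (-1 * -s) * Real.exp (-(3 / 5 * q)) ^ n := by gcongr
    _ = _ := by
      rw [← Real.exp_nat_mul, ← Real.exp_add]
      congr 1
      ring

/-- Powers beat logarithms. This ensures `D ≥ 1` for large `n`, without which the strict gap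
inequality fails. -/
lemma exists_nat_forall_one_le_rpow_div_log {C₀ c' : ℝ} (hC₀ : C₀ < 1) (hc' : 0 < c') :
    ∃ N : ℕ, ∀ n : ℕ, N ≤ n → 1 < (n : ℝ) →
      1 ≤ c' * (n : ℝ) ^ (1 - C₀) / Real.log n ^ (3 / 2 : ℝ) := by
  have h := (isLittleO_log_rpow_rpow_atTop (3 / 2) (sub_pos.2 hC₀)).bound hc'
  obtain ⟨N, hN⟩ := Filter.eventually_atTop.1 (tendsto_natCast_atTop_atTop.eventually h)
  refine ⟨N, fun n hn hn1 => ?_⟩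
  have hlog : 0 < Real.log n := Real.log_pos hn1
  have := hN n hn
  rw [Real.norm_of_nonneg (by positivity), Real.norm_of_nonneg (by positivity)] at this
  rwa [one_le_div (by positivity)]

theorem proposition2 (C₀ : ℝ) (hC₀ : 0 < C₀) (hC₀' : C₀ < 1) :
    ∃ c : ℝ, 0 < c ∧ ∃ c' : ℝ, 0 < c' ∧
      ∀ (n p : ℕ), 1 ≤ p → (p : ℝ) ≤ (1 - C₀) * n → Real.exp (2 / C₀) < n →
      ∀ (pen : Finset (Fin n) → ℝ),
        (∀ m ∈ modelIndices n p, 0 ≤ pen m) →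
        (∀ m ∈ modelIndices n p, pen m ≤ 2 * C₀ ^ 4 * (modelDim m : ℝ) * Real.log n) →
      ∀ (σ : ℝ), 0 < σ →
      ∀ {Ω : Type*} [MeasurableSpace Ω] (P : Measure Ω) [IsProbabilityMeasure P]
        (ε : Fin n → Ω → ℝ),
        (∀ i, HasLaw (ε i) (gaussianReal 0 1) P) → iIndepFun ε P →
      ∀ (mhat : Ω → Finset (Fin n)),
        (∀ᵐ ω ∂P, IsSelected p pen (observation 0 σ (fun i => ε i ω)) (mhat ω)) →
        1 - 2 * Real.exp (-c * ((n : ℝ) ^ (1 - C₀) / Real.sqrt (Real.log n))) ≤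
          P.real {ω | ⌊(1 - C₀) * (overfitDim C₀ c' n p : ℝ)⌋₊ < (mhat ω).card} := by
  set κ : ℝ := Real.exp (-(9 / 8)) / √(2 * Real.pi) / 2 with hκ
  have hκ0 : 0 < κ := by positivity
  have hsq : C₀ ^ 2 < 1 := by nlinarith
  -- Midpoint of `1` and `C₀⁻²`, so that both `r > 1` and `r C₀² < 1`.
  set r : ℝ := (1 + (C₀ ^ 2)⁻¹) / 2 with hr
  have hr1 : 1 < r := by
    have : 1 < (C₀ ^ 2)⁻¹ := (one_lt_inv₀ (by positivity)).2 hsq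
    linarith
  have hrC : r * C₀ ^ 2 = (1 + C₀ ^ 2) / 2 := by
    rw [hr]
    field_simp
    ring
  set η : ℝ := (r - 1 - Real.log r) / 2 with hη
  have hη0 : 0 < η := by
    have := Real.log_lt_sub_one_of_pos (by linarith : 0 < r) hr1.ne'
    linarith
  -- The first term keeps `D` below `κ x / 2`, the second gives `r C₀² n < n - D`.
  set c' : ℝ := min (κ / 2) ((1 - C₀ ^ 2) / 4) with hc'
  have hc'0 : 0 < c' := lt_min (by positivity) (by linarith)
  obtain ⟨N, hN⟩ := exists_nat_forall_one_le_rpow_div_log hC₀' hc'0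
  -- Here `κ / 10 = 3κ/5 - κ/2` serves the exceedances, `η` the sum of squares, and the last term
  -- the case `n < N`, where the claimed lower bound is at most `0`.
  set c : ℝ := min (min (κ / 10) η) (1 / (2 * (N + 1))) with hc
  have hc0 : 0 < c := lt_min (lt_min (by positivity) hη0) (by positivity)
  refine ⟨c, hc0, c', hc'0, ?_⟩
  intro n p hp hpn hn pen hpen₀ hpen σ hσ Ω _ P _ ε hlaw hindep mhat hsel
  have hn1 : (1 : ℝ) < n := lt_trans (Real.one_lt_exp_iff.2 (by positivity)) hn
  have hn0 : (0 : ℝ) < n := by linarith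
  have hC₀log : 2 < C₀ * Real.log n := by
    have := (Real.lt_log_iff_exp_lt hn0).2 hn
    rwa [div_lt_iff₀ hC₀, mul_comm] at this
  have hlog2 : 2 < Real.log n := by nlinarith
  have hlog0 : 0 < Real.log n := by linarith
  set x : ℝ := (n : ℝ) ^ (1 - C₀) / √(Real.log n) with hx
  have hx0 : 0 < x := by positivity
  have hsqrt1 : 1 ≤ √(Real.log n) := Real.one_le_sqrt.2 (by linarith)
  have hxn : x ≤ n := by
    rw [hx, div_le_iff₀ (by positivity)]
    calc (n : ℝ) ^ (1 - C₀) ≤ (n : ℝ) ^ (1 : ℝ) :=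
          Real.rpow_le_rpow_of_exponent_le hn1.le (by linarith)
      _ = n * 1 := by simp
      _ ≤ _ := by gcongr
  rcases lt_or_ge n N with hnN | hnN
  · have hcx : c * x ≤ 1 / 2 := by
      have h1 : x ≤ N + 1 := by
        have : (n : ℝ) < N := by exact_mod_cast hnN
        linarith
      calc c * x ≤ 1 / (2 * (N + 1)) * (N + 1) := by
            gcongr
            exact min_le_right _ _
        _ = 1 / 2 := by field_simp
    have := Real.one_sub_le_exp_neg (c * x)
    rw [← neg_mul] at this
    have hP : 0 ≤ P.real {ω | ⌊(1 - C₀) * (overfitDim C₀ c' n p : ℝ)⌋₊ < (mhat ω).card} :=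
      measureReal_nonneg
    linarith
  set D := overfitDim C₀ c' n p with hD
  have hfloor := hN n hnN hn1
  have hDp : D ≤ p := min_le_right _ _
  have hD1 : 1 ≤ D := le_min ((Nat.one_le_floor_iff _).2 hfloor) hp
  have hDx : (D : ℝ) ≤ c' * x := by
    have h1 : (D : ℝ) ≤ c' * (n : ℝ) ^ (1 - C₀) / Real.log n ^ (3 / 2 : ℝ) :=
      (Nat.cast_le.2 (min_le_left _ _)).trans (Nat.floor_le (by positivity))
    refine h1.trans ?_
    rw [hx, mul_div_assoc, Real.sqrt_eq_rpow]
    gcongr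
    · linarith
    · norm_num
  have hpn' : p < n := by
    have : (p : ℝ) < n := hpn.trans_lt (mul_lt_of_lt_one_left hn0 (by linarith))
    exact_mod_cast this
  -- Chosen so that `exp (-T / 2) = n^(-C₀)`; `n > e^(2/C₀)` gives `√T ≥ 2`, as the tail bound
  -- requires.
  set T : ℝ := 2 * C₀ * Real.log n with hT
  have hT4 : 4 ≤ T := by linarith
  have hgap : r * n * (2 * C₀ ^ 4 * Real.log n * D) < ((n : ℝ) - D) * (C₀ * D * T) := by
    have h1 : (D : ℝ) ≤ (1 - C₀ ^ 2) / 4 * n := by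
      refine hDx.trans (mul_le_mul (min_le_right _ _) hxn hx0.le (by linarith))
    have h2 : r * C₀ ^ 2 * n < n - D := by
      rw [hrC]
      have := mul_pos (sub_pos.2 hsq) hn0
      linarith
    have hDpos : (0 : ℝ) < D := by exact_mod_cast hD1
    have h3 : 0 < 2 * C₀ ^ 2 * Real.log n * D := by positivity
    calc _ = r * C₀ ^ 2 * n * (2 * C₀ ^ 2 * Real.log n * D) := by ring
      _ < (n - D) * (2 * C₀ ^ 2 * Real.log n * D) := mul_lt_mul_of_pos_right h2 h3
      _ = _ := by rw [hT]; ring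
  set q := (gaussianReal 0 1).real (Set.Ici √T) with hq
  have hnq : κ * x ≤ n * q := by
    have hT2 : 2 ≤ √T := Real.le_sqrt_of_sq_le (by linarith)
    have h1 := le_gaussianReal_real_Ici hT2
    rw [Real.sq_sqrt (by linarith)] at h1
    have h2 : Real.exp (-(T / 2)) = (n : ℝ) ^ (-C₀) := by
      rw [Real.rpow_def_of_pos hn0]
      congr 1
      rw [hT]
      ring
    have h3 : √T ≤ 2 * √(Real.log n) := by
      rw [show (2 : ℝ) * √(Real.log n) = √(4 * Real.log n) by
        rw [Real.sqrt_mul (by norm_num), show (4 : ℝ) = 2 ^ 2 by norm_num,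
          Real.sqrt_sq (by norm_num)]]
      refine Real.sqrt_le_sqrt ?_
      have := mul_le_mul_of_nonneg_right hC₀'.le hlog0.le
      linarith
    have h4 : (n : ℝ) ^ (1 - C₀) = n * (n : ℝ) ^ (-C₀) := by
      rw [sub_eq_add_neg, Real.rpow_add hn0, Real.rpow_one]
    calc κ * x = n * (Real.exp (-(9 / 8)) / √(2 * Real.pi) *
            ((n : ℝ) ^ (-C₀) / (2 * √(Real.log n)))) := by
          rw [hx, h4, hκ]
          field_simp
      _ ≤ n * (Real.exp (-(9 / 8)) / √(2 * Real.pi) * ((n : ℝ) ^ (-C₀) / √T)) := by gcongr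
      _ ≤ n * q := by
          rw [← h2]
          gcongr
  set A : Set Ω := {ω | ((Finset.univ.filter fun i => √T ≤ ε i ω).card : ℝ) ≤ κ * x / 2} with hA
  set E : Set Ω := {ω | r * n ≤ ∑ i, ε i ω ^ 2} with hE
  set G : Set Ω := {ω | ⌊(1 - C₀) * (D : ℝ)⌋₊ < (mhat ω).card} with hG
  have hPA : P.real A ≤ Real.exp (-c * x) := by
    refine (measureReal_card_exceedances_le hlaw hindep _ _).trans (Real.exp_le_exp.2 ?_)
    have : c ≤ κ / 10 := (min_le_left _ _).trans (min_le_left _ _)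
    have : c * x ≤ κ / 10 * x := by gcongr
    linarith
  have hPE : P.real E ≤ Real.exp (-c * x) := by
    refine (measureReal_sum_sq_ge_le hlaw hindep hr1).trans (Real.exp_le_exp.2 ?_)
    have : c ≤ η := (min_le_left _ _).trans (min_le_right _ _)
    have : c * x ≤ η * n := by gcongr
    rw [← hη, neg_mul, neg_mul]
    exact neg_le_neg this
  have hcover : ∀ᵐ ω ∂P, ω ∈ (Set.univ : Set Ω) → ω ∈ G ∪ (A ∪ E) := by
    filter_upwards [hsel] with ω hω _
    by_contra hnot
    simp only [Set.mem_union, not_or] at hnot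
    obtain ⟨hωG, hωA, hωE⟩ := hnot
    refine hωG (floor_lt_card_of_isSelected (T := T) (R := r * n) (B := 2 * C₀ ^ 4 * Real.log n)
      hC₀' hσ (by positivity) (by linarith) hpn' hDp hpen₀ (fun m hm => ?_) hω ?_
      (not_le.1 hωE).le hgap)
    · exact (hpen m hm).trans_eq (by ring)
    · have h1 : (D : ℝ) ≤ κ * x / 2 := by
        refine hDx.trans ?_
        have : c' * x ≤ κ / 2 * x := mul_le_mul_of_nonneg_right (min_le_left _ _) hx0.le
        linarith
      have h2 := h1.trans (not_le.1 hωA).le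
      refine (Nat.cast_le.1 h2).trans (Finset.card_le_card fun i hi => ?_)
      simp only [Finset.mem_filter, Finset.mem_univ, true_and] at hi ⊢
      rw [← Real.sq_sqrt (by linarith : 0 ≤ T)]
      exact pow_le_pow_left₀ (Real.sqrt_nonneg _) hi 2
  have hone : (1 : ℝ) ≤ P.real (G ∪ (A ∪ E)) := by
    have : P Set.univ ≤ P (G ∪ (A ∪ E)) := measure_mono_ae hcover
    have := ENNReal.toReal_mono (measure_ne_top P _) this
    rwa [measure_univ, ENNReal.toReal_one] at this
  have h1 := measureReal_union_le (μ := P) G (A ∪ E)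
  have h2 := measureReal_union_le (μ := P) A E
  linarith
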